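/- Let $G$ be a real, connected, finite-dimensional Lie group (not necessarily compact), $G\neq\{e\}$, whose Lie algebra is semisimple. Let $\mathcal{X}$ be a linear vector field on $G$, that is, a smooth vector field whose flow $(\varphi_t)_{t\in\mathbb{R}}$ is a family of automorphisms of the Lie group $G$. Let $g\in G$ be a fixed point of the flow, that is, $\varphi_t(g)=g$ for all $t\in\mathbb{R}$. Then: 1. $g$ is not asymptotically stable. Here $g$ is called stable if for every neighborhood $U$ of $g$ there is a neighborhood $V$ of $g$ with $\varphi_t(V)\subset U$ for all $t\ge 0$, and asymptotically stable if it is stable and there is a neighborhood $W$ of $g$ such that $\lim_{t\to\infty}\varphi_t(x)=g$ for all $x\in W$. 2. $g$ is not exponentially stable. That is, for the distance $\varrho$ of any smooth Riemannian metric on $G$ (in particular of any left invariant one), there do not exist constants $c,\mu>0$ and a neighborhood $W$ of $g$ such that $\varrho(\varphi_t(x),g)\le c\,e^{-\mu t}\varrho(x,g)$ for all $x\in W$ and all $t\ge 0$. -/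

import Mathlib

open scoped Manifold ContDiff Topology Bundle

noncomputable section

namespace LinearFlow

/-- Over `ℝ` the Lie algebra of a Lie group only needs `C^3` smoothness, so that a smooth Lie group
has one. -/
instance instLEInftyMinSmoothness : ENat.LEInfty (minSmoothness ℝ 3) :=
  ⟨by rw [minSmoothness_of_isRCLikeNormedField]; exact ENat.LEInfty.out⟩

variable {E : Type*} [NormedAddCommGroup E] [NormedSpace ℝ E]
  {G : Type*} [TopologicalSpace G] [ChartedSpace E G]

/-- `φ` is the (global) flow of the vector field `X`: for each `g`, the curve `t ↦ φ t g` is the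
solution of `ġ = X(g)` starting at `g`. -/
def IsFlow (X : ∀ g : G, TangentSpace 𝓘(ℝ, E) g) (φ : ℝ → G → G) : Prop :=
  ∀ g : G, φ 0 g = g ∧ IsMIntegralCurve (I := 𝓘(ℝ, E)) (fun t => φ t g) X

/-- `f` is an automorphism of the Lie group `G`: a group automorphism which is smooth and has a
smooth inverse. -/
def IsLieGroupAutomorphism (E : Type*) [NormedAddCommGroup E] [NormedSpace ℝ E]
    {G : Type*} [TopologicalSpace G] [ChartedSpace E G] [Group G] (f : G → G) : Prop :=
  ∃ F : G ≃* G, (∀ g, F g = f g) ∧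
    ContMDiff 𝓘(ℝ, E) 𝓘(ℝ, E) ∞ F ∧ ContMDiff 𝓘(ℝ, E) 𝓘(ℝ, E) ∞ F.symm

/-- A linear vector field on `G`: a smooth vector field whose flow consists of automorphisms of
the Lie group `G`. -/
def IsLinearVectorField [IsManifold 𝓘(ℝ, E) 1 G] [Group G]
    (X : ∀ g : G, TangentSpace 𝓘(ℝ, E) g) : Prop :=
  ContMDiff 𝓘(ℝ, E) 𝓘(ℝ, E).tangent ∞
      (fun g => (⟨g, X g⟩ : TangentBundle 𝓘(ℝ, E) G)) ∧
    ∃ φ : ℝ → G → G, IsFlow X φ ∧ ∀ t, IsLieGroupAutomorphism E (φ t)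

/-- `g` is a fixed point of the flow `φ`. -/
def IsFixedPoint {G : Type*} (φ : ℝ → G → G) (g : G) : Prop :=
  ∀ t, φ t g = g

/-- `g` is stable: each neighborhood `U` of `g` contains `φ t (V)`, `t ≥ 0`, for some neighborhood
`V` of `g`. -/
def IsStable {G : Type*} [TopologicalSpace G] (φ : ℝ → G → G) (g : G) : Prop :=
  ∀ U ∈ 𝓝 g, ∃ V ∈ 𝓝 g, ∀ t : ℝ, 0 ≤ t → φ t '' V ⊆ U

/-- `g` is asymptotically stable: it is stable and attracts a neighborhood of itself. -/
def IsAsymptoticallyStable {G : Type*} [TopologicalSpace G] (φ : ℝ → G → G) (g : G) : Prop :=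
  IsStable φ g ∧
    ∃ W ∈ 𝓝 g, ∀ x ∈ W, Filter.Tendsto (fun t => φ t x) Filter.atTop (𝓝 g)

/-- The distance of the Riemannian metric `m` on `G`, i.e. the infimum of the lengths of the
`C^1` paths between two points. It is finite if `G` is connected. -/
def metricDist [IsManifold 𝓘(ℝ, E) 1 G]
    (m : Bundle.ContMDiffRiemannianMetric 𝓘(ℝ, E) ∞ E
      (fun x : G => TangentSpace 𝓘(ℝ, E) x))
    (x y : G) : ENNReal :=
  letI : Bundle.RiemannianBundle (fun x : G => TangentSpace 𝓘(ℝ, E) x) :=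
    ⟨m.toRiemannianMetric⟩
  Manifold.riemannianEDist 𝓘(ℝ, E) x y

/-- `g` is exponentially stable with respect to the distance `ϱ` of the Riemannian metric `m`:
`ϱ(φ_t(x), g) ≤ c e^{-μ t} ϱ(x, g)` for all `t ≥ 0` and all `x` in a neighborhood of `g`, with
constants `c, μ > 0`. -/
def IsExponentiallyStable [IsManifold 𝓘(ℝ, E) 1 G]
    (m : Bundle.ContMDiffRiemannianMetric 𝓘(ℝ, E) ∞ E
      (fun x : G => TangentSpace 𝓘(ℝ, E) x))
    (φ : ℝ → G → G) (g : G) : Prop :=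
  ∃ c μ : ℝ, 0 < c ∧ 0 < μ ∧ ∃ W ∈ 𝓝 g, ∀ x ∈ W, ∀ t : ℝ, 0 ≤ t →
    metricDist m (φ t x) g ≤ ENNReal.ofReal (c * Real.exp (-μ * t)) * metricDist m x g

end LinearFlow

end

/-! Suppose the fixed point `g` were asymptotically stable. Since `φ t (g * x) = g * φ t x`, left
translation moves the situation to the identity. There, asymptotic stability forces the
differentials `A t` of `φ t` to tend to 0 pointwise on the Lie algebra
(`tendsto_differentialOne_zero`). They are Lie algebra automorphisms (`differentialOne_lie`), hence
preserve the Killing form κ, so κ(x, y) = κ(A t x, A t y) → κ(0, 0) = 0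
(`subsingleton_of_tendsto_lieEquiv_zero`). By Cartan's criterion κ is nondegenerate, so the Lie
algebra is zero, `G` is discrete and, being connected, trivial. Exponential stability is excluded
because it implies asymptotic stability: a Riemannian distance induces the topology of `G`. -/

namespace LinearFlow

open Filter VectorField

/-- A finite-dimensional real Lie algebra with nondegenerate Killing form has no family of
automorphisms contracting every vector to `0`, unless it is trivial. -/
theorem subsingleton_of_tendsto_lieEquiv_zero {L : Type*} [LieRing L] [LieAlgebra ℝ L]
    [FiniteDimensional ℝ L] [TopologicalSpace L] [IsTopologicalAddGroup L] [ContinuousSMul ℝ L]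
    [T2Space L] [LieAlgebra.IsKilling ℝ L] {ι : Type*} {l : Filter ι} [l.NeBot]
    (A : ι → L ≃ₗ⁅ℝ⁆ L) (hA : ∀ x, Tendsto (fun i => A i x) l (𝓝 0)) : Subsingleton L := by
  have hκ : ∀ x y, killingForm ℝ L x y = 0 := by
    intro x y
    have hc : Continuous fun p : L × L => killingForm ℝ L p.1 p.2 := by
      let b := Module.finBasis ℝ L
      have hb : ∀ i, Continuous fun z : L => b.repr z i := fun i =>
        (b.coord i).continuous_of_finiteDimensional
      have hs : (fun p : L × L => killingForm ℝ L p.1 p.2) = fun p : L × L =>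
          ∑ i, ∑ j, b.repr p.1 i * (b.repr p.2 j * killingForm ℝ L (b i) (b j)) := by
        ext p
        conv_lhs => rw [← b.sum_repr p.1, ← b.sum_repr p.2]
        simp only [map_sum, map_smul, LinearMap.sum_apply, LinearMap.smul_apply, smul_eq_mul]
        simp only [Finset.mul_sum]
        rw [Finset.sum_comm]
        exact Finset.sum_congr rfl fun i _ => Finset.sum_congr rfl fun j _ => by ring
      rw [hs]
      exact continuous_finsetSum _ fun i _ => continuous_finsetSum _ fun j _ =>
        ((hb i).comp continuous_fst).mul (((hb j).comp continuous_snd).mul continuous_const)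
    have h := (hc.tendsto (0, 0)).comp ((hA x).prodMk_nhds (hA y))
    -- Automorphisms preserve the Killing form, so the convergent family is constant.
    have h' : Tendsto (fun _ : ι => killingForm ℝ L x y) l (𝓝 0) := by
      simpa [Function.comp_def] using h
    exact tendsto_nhds_unique tendsto_const_nhds h'
  refine subsingleton_of_forall_eq 0 fun x => ?_
  have : x ∈ LinearMap.ker (killingForm ℝ L) := by
    rw [LinearMap.mem_ker]; ext y; exact hκ x y
  simpa using this

/-! ### Differentials of automorphisms at the identity -/

section Differential

variable {E : Type*} [NormedAddCommGroup E] [NormedSpace ℝ E]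
  {G : Type*} [TopologicalSpace G] [ChartedSpace E G] [Group G]

/-- The differential at `1` of a map `f` fixing `1`, as an endomorphism of the Lie algebra. -/
noncomputable def differentialOne (f : G → G) :
    GroupLieAlgebra 𝓘(ℝ, E) G →L[ℝ] GroupLieAlgebra 𝓘(ℝ, E) G :=
  (mfderiv 𝓘(ℝ, E) 𝓘(ℝ, E) f (1 : G) : E →L[ℝ] E)

variable [LieGroup 𝓘(ℝ, E) ∞ G]

theorem mdifferentiable_mul_left (g : G) :
    MDifferentiable 𝓘(ℝ, E) 𝓘(ℝ, E) (fun x : G => g * x) :=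
  (contMDiff_mul_left (I := 𝓘(ℝ, E)) (n := ∞)).mdifferentiable (by simp)

/-- A smooth group automorphism maps the left invariant vector field of `v` to that of the image
of `v` under the differential. -/
theorem mfderiv_mulInvariantVectorField (F : G ≃* G)
    (hF : MDifferentiable 𝓘(ℝ, E) 𝓘(ℝ, E) F) (v : GroupLieAlgebra 𝓘(ℝ, E) G) (p : G) :
    mfderiv 𝓘(ℝ, E) 𝓘(ℝ, E) F p (mulInvariantVectorField v p) =
      mulInvariantVectorField (I := 𝓘(ℝ, E)) (differentialOne F v) (F p) := by
  have h1 : mfderiv 𝓘(ℝ, E) 𝓘(ℝ, E) (F ∘ fun x : G => p * x) 1 =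
      (mfderiv 𝓘(ℝ, E) 𝓘(ℝ, E) F (p * 1)).comp (mfderiv 𝓘(ℝ, E) 𝓘(ℝ, E) (fun x : G => p * x) 1) :=
    mfderiv_comp (I' := 𝓘(ℝ, E)) _ (hF _) (mdifferentiable_mul_left p _)
  have h2 : mfderiv 𝓘(ℝ, E) 𝓘(ℝ, E) ((fun x : G => F p * x) ∘ F) 1 =
      (mfderiv 𝓘(ℝ, E) 𝓘(ℝ, E) (fun x : G => F p * x) (F 1)).comp
        (mfderiv 𝓘(ℝ, E) 𝓘(ℝ, E) F 1) :=
    mfderiv_comp (I' := 𝓘(ℝ, E)) _ (mdifferentiable_mul_left (F p) _) (hF _)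
  have h3 : (F ∘ fun x : G => p * x) = (fun x : G => F p * x) ∘ F := by ext x; simp
  -- The equalities `p * 1 = p` and `F 1 = 1` are only propositional; reading every tangent space as
  -- `E` allows transport along them.
  have hq : ∀ q : G, q = p → (mfderiv 𝓘(ℝ, E) 𝓘(ℝ, E) F q : E →L[ℝ] E) =
      (mfderiv 𝓘(ℝ, E) 𝓘(ℝ, E) F p : E →L[ℝ] E) := by rintro q rfl; rfl
  have hr : ∀ q : G, q = 1 → (mfderiv 𝓘(ℝ, E) 𝓘(ℝ, E) (fun x : G => F p * x) q : E →L[ℝ] E) =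
      (mfderiv 𝓘(ℝ, E) 𝓘(ℝ, E) (fun x : G => F p * x) 1 : E →L[ℝ] E) := by rintro q rfl; rfl
  have e1 := congrArg (fun T : E →L[ℝ] E => T v) h1
  have e2 := congrArg (fun T : E →L[ℝ] E => T v) h2
  have e0 : (mfderiv 𝓘(ℝ, E) 𝓘(ℝ, E) (F ∘ fun x : G => p * x) 1 : E →L[ℝ] E) v =
    (mfderiv 𝓘(ℝ, E) 𝓘(ℝ, E) ((fun x : G => F p * x) ∘ F) 1 : E →L[ℝ] E) v := by rw [h3]
  have f1 := congrArg (fun T : E →L[ℝ] E => T (mulInvariantVectorField (I := 𝓘(ℝ, E)) v p))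
    (hq (p * 1) (mul_one p))
  have f2 := congrArg (fun T : E →L[ℝ] E => T (mfderiv 𝓘(ℝ, E) 𝓘(ℝ, E) F 1 v))
    (hr (F 1) (map_one F))
  exact f1.symm.trans (e1.symm.trans (e0.trans (e2.trans f2)))

/-- The diffeomorphism underlying an automorphism of a Lie group. -/
def diffeomorphOfMulEquiv (F : G ≃* G) (hF : ContMDiff 𝓘(ℝ, E) 𝓘(ℝ, E) ∞ F)
    (hF' : ContMDiff 𝓘(ℝ, E) 𝓘(ℝ, E) ∞ F.symm) : G ≃ₘ^∞⟮𝓘(ℝ, E), 𝓘(ℝ, E)⟯ G where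
  toEquiv := F.toEquiv
  contMDiff_toFun := hF
  contMDiff_invFun := hF'

/-- The differential at `1` of an automorphism of a Lie group is a homomorphism of Lie algebras. -/
theorem differentialOne_lie [CompleteSpace E] (F : G ≃* G)
    (hF : ContMDiff 𝓘(ℝ, E) 𝓘(ℝ, E) ∞ F) (hF' : ContMDiff 𝓘(ℝ, E) 𝓘(ℝ, E) ∞ F.symm)
    (v w : GroupLieAlgebra 𝓘(ℝ, E) G) :
    differentialOne F ⁅v, w⁆ = ⁅differentialOne F v, differentialOne F w⁆ := by
  have hd := hF.mdifferentiable (by simp)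
  let e : ∀ p : G, TangentSpace 𝓘(ℝ, E) p ≃L[ℝ] TangentSpace 𝓘(ℝ, E) (F p) := fun p =>
    (diffeomorphOfMulEquiv F hF hF').mfderivToContinuousLinearEquiv (by simp) p
  have he : ∀ p, mfderiv 𝓘(ℝ, E) 𝓘(ℝ, E) F p = (e p).toContinuousLinearMap := fun p => rfl
  have hp : ∀ u : GroupLieAlgebra 𝓘(ℝ, E) G, mpullback 𝓘(ℝ, E) 𝓘(ℝ, E) F
      (mulInvariantVectorField (differentialOne F u)) = mulInvariantVectorField u := by
    intro u
    ext p
    rw [mpullback_apply, ← mfderiv_mulInvariantVectorField F hd, he,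
      ContinuousLinearMap.inverse_equiv]
    exact (e p).symm_apply_apply _
  -- Pullback commutes with brackets of vector fields; at 1 the bracket of left invariant fields is
  -- the Lie algebra bracket.
  have key := mpullback_mlieBracket (n := ∞) (I := 𝓘(ℝ, E)) (I' := 𝓘(ℝ, E)) (f := F) (x₀ := 1)
    (V := mulInvariantVectorField (differentialOne F v))
    (W := mulInvariantVectorField (differentialOne F w))
    (mdifferentiableAt_mulInvariantVectorField _) (mdifferentiableAt_mulInvariantVectorField _)
    (hF _) (by rw [minSmoothness_of_isRCLikeNormedField]; exact ENat.LEInfty.out)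
  rw [hp, hp, mpullback_apply, he, ContinuousLinearMap.inverse_equiv] at key
  have h1 := congrArg (e 1) key
  have h2 := ((e 1).apply_symm_apply _).symm.trans h1
  have h3 : ∀ q : G, q = 1 → (mlieBracket 𝓘(ℝ, E) (mulInvariantVectorField (differentialOne F v))
      (mulInvariantVectorField (differentialOne F w)) q : E) =
      (mlieBracket 𝓘(ℝ, E) (mulInvariantVectorField (differentialOne F v))
      (mulInvariantVectorField (differentialOne F w)) (1 : G) : E) := by rintro q rfl; rfl
  exact h2.symm.trans (h3 (F 1) (map_one F))

/-- The Lie algebra automorphism which is the differential at `1` of an automorphism of a Lie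
group. -/
noncomputable def differentialLieEquiv [CompleteSpace E] (F : G ≃* G)
    (hF : ContMDiff 𝓘(ℝ, E) 𝓘(ℝ, E) ∞ F) (hF' : ContMDiff 𝓘(ℝ, E) 𝓘(ℝ, E) ∞ F.symm) :
    GroupLieAlgebra 𝓘(ℝ, E) G ≃ₗ⁅ℝ⁆ GroupLieAlgebra 𝓘(ℝ, E) G :=
  LieEquiv.ofBijective
    { (differentialOne F : GroupLieAlgebra 𝓘(ℝ, E) G →L[ℝ] GroupLieAlgebra 𝓘(ℝ, E) G).toLinearMap
      with map_lie' := fun {v w} => differentialOne_lie F hF hF' v w }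
    ((diffeomorphOfMulEquiv F hF hF').mfderivToContinuousLinearEquiv (by simp) 1).bijective

/-- The left invariant vector field of `v` at `q`, read in the chart at `1`, as a linear function
of `v`. -/
noncomputable def leftTranslationInChart (E : Type*) [NormedAddCommGroup E] [NormedSpace ℝ E]
    {G : Type*} [TopologicalSpace G] [ChartedSpace E G] [Group G] (q : G) : E →L[ℝ] E :=
  (mfderiv 𝓘(ℝ, E) 𝓘(ℝ, E) (extChartAt 𝓘(ℝ, E) (1 : G)) q : E →L[ℝ] E).comp
    (mfderiv 𝓘(ℝ, E) 𝓘(ℝ, E) (fun x : G => q * x) 1 : E →L[ℝ] E)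

theorem leftTranslationInChart_one :
    leftTranslationInChart E (1 : G) = ContinuousLinearMap.id ℝ E := by
  have : IsManifold 𝓘(ℝ, E) 1 G := inferInstance
  have h1 : (fun x : G => 1 * x) = id := by ext; simp
  have h2 : mfderiv 𝓘(ℝ, E) 𝓘(ℝ, E) (fun x : G => 1 * x) 1 =
    (ContinuousLinearMap.id ℝ E : E →L[ℝ] E) := by rw [h1]; exact mfderiv_id
  have h3 := mfderiv_extChartAt_self (I := 𝓘(ℝ, E)) (x := (1 : G))
  ext v
  have e2 := congrArg (fun T : E →L[ℝ] E => T v) h2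
  have e3 := congrArg (fun T : E →L[ℝ] E => T v) h3
  refine Eq.trans ?_ e3
  exact congrArg (mfderiv 𝓘(ℝ, E) 𝓘(ℝ, E) (extChartAt 𝓘(ℝ, E) (1 : G)) 1 : E →L[ℝ] E) e2

/-- In finite dimension continuity can be tested on each vector `v`, where the map is the smooth
left invariant field of `v` in the trivialization at 1. -/
theorem continuousAt_leftTranslationInChart [FiniteDimensional ℝ E] :
    ContinuousAt (leftTranslationInChart E : G → E →L[ℝ] E) 1 := by
  rw [continuousAt_clm_apply]
  intro v
  have hv := (contMDiffAt_mulInvariantVectorField (I := 𝓘(ℝ, E)) (G := G) v (g := 1))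
  rw [Bundle.contMDiffAt_section] at hv
  refine hv.continuousAt.congr ?_
  filter_upwards [(chartAt E (1 : G)).open_source.mem_nhds (mem_chart_source E (1 : G))] with q hq
  have h := TangentBundle.continuousLinearMapAt_trivializationAt (I := 𝓘(ℝ, E)) hq
  have e := congrArg (fun T : E →L[ℝ] E => T (mulInvariantVectorField (I := 𝓘(ℝ, E)) v q)) h
  refine Eq.trans ?_ e
  have hb : q ∈ (trivializationAt E (TangentSpace 𝓘(ℝ, E)) (1 : G)).baseSet := hq
  exact (congrFun ((trivializationAt E (TangentSpace 𝓘(ℝ, E)) (1 : G)).coe_linearMapAt_of_mem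
    (R := ℝ) hb) _).symm

end Differential

/-! ### Asymptotic stability contracts the Lie algebra -/

section Contraction

variable {E : Type*} [NormedAddCommGroup E] [NormedSpace ℝ E]
  {G : Type*} [TopologicalSpace G] [ChartedSpace E G] [Group G] [LieGroup 𝓘(ℝ, E) ∞ G]

/-- The image under an automorphism `F` of an integral curve of a left invariant vector field, read
in the chart at `1`. -/
theorem hasDerivAt_extChartAt_comp (F : G ≃* G) (hF : MDifferentiable 𝓘(ℝ, E) 𝓘(ℝ, E) F)
    {γ : ℝ → G} {v : GroupLieAlgebra 𝓘(ℝ, E) G} {s : ℝ}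
    (hγ : HasMFDerivAt 𝓘(ℝ, ℝ) 𝓘(ℝ, E) γ s
      ((1 : ℝ →L[ℝ] ℝ).smulRight (mulInvariantVectorField v (γ s))))
    (hs : F (γ s) ∈ (chartAt E (1 : G)).source) :
    HasDerivAt (fun r => extChartAt 𝓘(ℝ, E) (1 : G) (F (γ r)))
      (leftTranslationInChart E (F (γ s)) (differentialOne F v)) s := by
  have : IsManifold 𝓘(ℝ, E) 1 G := inferInstance
  have hκ := (mdifferentiableAt_extChartAt (I := 𝓘(ℝ, E)) hs).hasMFDerivAt
  have h := HasMFDerivAt.comp s hκ (HasMFDerivAt.comp s (hF (γ s)).hasMFDerivAt hγ)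
  let K : E →L[ℝ] E := mfderiv 𝓘(ℝ, E) 𝓘(ℝ, E) (extChartAt 𝓘(ℝ, E) (1 : G)) (F (γ s))
  let T : E →L[ℝ] E := mfderiv 𝓘(ℝ, E) 𝓘(ℝ, E) F (γ s)
  let u : E := mulInvariantVectorField (I := 𝓘(ℝ, E)) v (γ s)
  have h' : HasFDerivAt (fun r => extChartAt 𝓘(ℝ, E) (1 : G) (F (γ r)))
      (K.comp (T.comp ((1 : ℝ →L[ℝ] ℝ).smulRight u))) s := hasMFDerivAt_iff_hasFDerivAt.1 h
  have e : K (T ((1 : ℝ) • u)) = leftTranslationInChart E (F (γ s)) (differentialOne F v) := by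
    rw [one_smul]
    exact congrArg K (mfderiv_mulInvariantVectorField F hF v (γ s))
  exact h'.hasDerivAt.congr_deriv e

/-- If the identity is asymptotically stable for a family of automorphisms, then their differentials
at the identity contract every vector to `0`. -/
theorem tendsto_differentialOne_zero [FiniteDimensional ℝ E] (F : ℝ → G ≃* G)
    (hF : ∀ t, MDifferentiable 𝓘(ℝ, E) 𝓘(ℝ, E) (F t))
    (hs : IsAsymptoticallyStable (fun t x => F t x) (1 : G)) (v : GroupLieAlgebra 𝓘(ℝ, E) G) :
    Tendsto (fun t => differentialOne (F t) v) atTop (𝓝 0) := by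
  have : IsManifold 𝓘(ℝ, E) 1 G := inferInstance
  have : CompleteSpace E := FiniteDimensional.complete ℝ E
  obtain ⟨hst, W, hW, hWt⟩ := hs
  have hU : {q : G | q ∈ (chartAt E (1 : G)).source ∧
      ‖leftTranslationInChart E q - ContinuousLinearMap.id ℝ E‖ < 1 / 2} ∈ 𝓝 (1 : G) := by
    refine inter_mem (chart_source_mem_nhds E (1 : G)) ?_
    have hc := (continuousAt_leftTranslationInChart (E := E) (G := G)).sub
      (continuousAt_const (y := ContinuousLinearMap.id ℝ E))
    have hn := hc.norm
    refine hn.eventually_lt (continuousAt_const (y := (1 / 2 : ℝ))) ?_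
    simp [leftTranslationInChart_one]
  obtain ⟨V, hV, hVU⟩ := hst _ hU
  have hc1 : ContMDiffAt 𝓘(ℝ, E) 𝓘(ℝ, E).tangent 1 (fun g : G =>
      (⟨g, mulInvariantVectorField v g⟩ : TangentBundle 𝓘(ℝ, E) G)) 1 :=
    (contMDiffAt_mulInvariantVectorField (I := 𝓘(ℝ, E)) v).of_le
      (by rw [minSmoothness_of_isRCLikeNormedField]; norm_num)
  -- A local integral curve through 1 replaces the exponential map.
  obtain ⟨γ, hγ0, hγ⟩ :=
    exists_isMIntegralCurveAt_of_contMDiffAt_boundaryless (t₀ := 0) hc1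
  have hγc := hγ.continuousAt
  have hev : ∀ᶠ s in 𝓝 (0 : ℝ), HasMFDerivAt 𝓘(ℝ, ℝ) 𝓘(ℝ, E) γ s
      ((1 : ℝ →L[ℝ] ℝ).smulRight (mulInvariantVectorField v (γ s))) ∧ γ s ∈ V ∩ W := by
    refine Filter.Eventually.and hγ (hγc ?_)
    rw [hγ0]; exact inter_mem hV hW
  obtain ⟨ε, hε, hball⟩ := Metric.eventually_nhds_iff_ball.1 hev
  set s₀ := ε / 2 with hs₀
  have hs₀pos : 0 < s₀ := by positivity
  have hseg : ∀ s ∈ Set.Icc 0 s₀, s ∈ Metric.ball (0 : ℝ) ε := by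
    intro s hs
    rw [Metric.mem_ball, dist_zero_right, Real.norm_eq_abs, abs_of_nonneg hs.1]
    linarith [hs.2]
  let κ : G → E := extChartAt 𝓘(ℝ, E) (1 : G)
  let D : ℝ → E := fun t => differentialOne (F t) v
  -- In the chart, `F t ∘ γ` has velocity within `‖w‖ / 2` of `w = D t`, so over time `s₀` it moves
  -- by at least `s₀ * ‖w‖ / 2`. Stability keeps the curve in the chart for all `t ≥ 0`, so `s₀`
  -- does not depend on `t`.
  have hest : ∀ t : ℝ, 0 ≤ t → ‖D t‖ ≤ 2 / s₀ * ‖κ (F t (γ s₀)) - κ 1‖ := by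
    intro t ht
    set w : E := D t
    have hmem : ∀ s ∈ Set.Icc 0 s₀, F t (γ s) ∈ {q : G | q ∈ (chartAt E (1 : G)).source ∧
        ‖leftTranslationInChart E q - ContinuousLinearMap.id ℝ E‖ < 1 / 2} := fun s hs =>
      hVU t ht ⟨γ s, (hball s (hseg s hs)).2.1, rfl⟩
    have hder : ∀ s ∈ Set.Icc 0 s₀, HasDerivWithinAt (fun r => κ (F t (γ r)) - r • w)
        (leftTranslationInChart E (F t (γ s)) w - (1 : ℝ) • w) (Set.Icc 0 s₀) s := fun s hs =>
      ((hasDerivAt_extChartAt_comp (F t) (hF t) (hball s (hseg s hs)).1 (hmem s hs).1).sub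
        ((hasDerivAt_id s).smul_const w)).hasDerivWithinAt
    have hbd : ∀ s ∈ Set.Ico 0 s₀,
        ‖leftTranslationInChart E (F t (γ s)) w - (1 : ℝ) • w‖ ≤ 1 / 2 * ‖w‖ := by
      intro s hs
      have h := (leftTranslationInChart E (F t (γ s)) - ContinuousLinearMap.id ℝ E).le_of_opNorm_le
        (hmem s ⟨hs.1, hs.2.le⟩).2.le w
      simpa using h
    have hmv := norm_image_sub_le_of_norm_deriv_le_segment' hder hbd s₀ ⟨hs₀pos.le, le_rfl⟩
    simp only [hγ0, map_one, zero_smul, sub_zero] at hmv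
    have htri : ‖s₀ • w‖ ≤ ‖κ (F t (γ s₀)) - κ 1‖ + ‖κ (F t (γ s₀)) - s₀ • w - κ 1‖ := by
      have : s₀ • w = (κ (F t (γ s₀)) - κ 1) - (κ (F t (γ s₀)) - s₀ • w - κ 1) := by abel
      conv_lhs => rw [this]
      exact norm_sub_le _ _
    rw [norm_smul, Real.norm_eq_abs, abs_of_pos hs₀pos] at htri
    rw [div_mul_eq_mul_div, le_div_iff₀ hs₀pos]
    linarith
  have hlim : Tendsto (fun t => 2 / s₀ * ‖κ (F t (γ s₀)) - κ 1‖) atTop (𝓝 0) := by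
    have h1 := hWt (γ s₀) (hball s₀ (hseg s₀ ⟨hs₀pos.le, le_rfl⟩)).2.2
    have h2 := (continuousAt_extChartAt (I := 𝓘(ℝ, E)) (1 : G)).tendsto.comp h1
    have h3 := ((h2.sub_const (κ 1)).norm).const_mul (2 / s₀)
    simpa [κ, Function.comp_def] using h3
  have hD : Tendsto D atTop (𝓝 0) := squeeze_zero_norm' ((eventually_ge_atTop 0).mono hest) hlim
  exact hD

end Contraction

/-! ### Translation to the identity, and Riemannian distances -/

section Stability

theorem IsAsymptoticallyStable.one_of_fixedPoint {G : Type*} [Group G] [TopologicalSpace G]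
    [IsTopologicalGroup G] (F : ℝ → G ≃* G) {g : G} (hg : ∀ t, F t g = g)
    (h : IsAsymptoticallyStable (fun t x => F t x) g) :
    IsAsymptoticallyStable (fun t x => F t x) (1 : G) := by
  obtain ⟨hst, W, hW, hWt⟩ := h
  have hm : Tendsto (fun x : G => g * x) (𝓝 1) (𝓝 g) := by
    simpa using (continuous_const_mul g).tendsto (1 : G)
  have hm' : Tendsto (fun x : G => g⁻¹ * x) (𝓝 g) (𝓝 1) := by
    simpa using (continuous_const_mul g⁻¹).tendsto g
  refine ⟨fun U hU => ?_, _, hm hW, fun x hx => ?_⟩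
  · obtain ⟨V, hV, hVU⟩ := hst _ (hm' hU)
    refine ⟨_, hm hV, fun t ht => ?_⟩
    rintro _ ⟨x, hx, rfl⟩
    have := hVU t ht ⟨g * x, hx, rfl⟩
    simpa [hg t] using this
  · simpa [Function.comp_def, hg] using hm'.comp (hWt (g * x) hx)

variable {E : Type*} [NormedAddCommGroup E] [NormedSpace ℝ E]
  {G : Type*} [TopologicalSpace G] [ChartedSpace E G]

theorem eventually_metricDist_lt [IsManifold 𝓘(ℝ, E) 1 G]
    (m : Bundle.ContMDiffRiemannianMetric 𝓘(ℝ, E) ∞ E (fun x : G => TangentSpace 𝓘(ℝ, E) x))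
    (g : G) {c : ENNReal} (hc : 0 < c) : ∀ᶠ x in 𝓝 g, metricDist m x g < c := by
  let : Bundle.RiemannianBundle (fun x : G => TangentSpace 𝓘(ℝ, E) x) :=
    ⟨m.toRiemannianMetric⟩
  have : IsContinuousRiemannianBundle E (fun x : G => TangentSpace 𝓘(ℝ, E) x) :=
    ⟨⟨m.inner, m.contMDiff.continuous, fun _ _ _ => rfl⟩⟩
  filter_upwards [eventually_riemannianEDist_lt 𝓘(ℝ, E) g hc] with x hx
  rw [Manifold.riemannianEDist_comm] at hx
  exact hx

theorem exists_setOf_metricDist_lt_subset [IsManifold 𝓘(ℝ, E) 1 G] [RegularSpace G]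
    (m : Bundle.ContMDiffRiemannianMetric 𝓘(ℝ, E) ∞ E (fun x : G => TangentSpace 𝓘(ℝ, E) x))
    {g : G} {U : Set G} (hU : U ∈ 𝓝 g) : ∃ c > 0, {x | metricDist m x g < c} ⊆ U := by
  let : Bundle.RiemannianBundle (fun x : G => TangentSpace 𝓘(ℝ, E) x) :=
    ⟨m.toRiemannianMetric⟩
  have : IsContinuousRiemannianBundle E (fun x : G => TangentSpace 𝓘(ℝ, E) x) :=
    ⟨⟨m.inner, m.contMDiff.continuous, fun _ _ _ => rfl⟩⟩
  obtain ⟨c, hc, h⟩ := setOfPred_riemannianEDist_lt_subset_nhds' 𝓘(ℝ, E) hU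
  refine ⟨c, hc, fun x hx => h ?_⟩
  rw [Set.mem_ofPred_eq, Manifold.riemannianEDist_comm]
  exact hx

theorem IsExponentiallyStable.isAsymptoticallyStable [IsManifold 𝓘(ℝ, E) 1 G] [RegularSpace G]
    {m : Bundle.ContMDiffRiemannianMetric 𝓘(ℝ, E) ∞ E (fun x : G => TangentSpace 𝓘(ℝ, E) x)}
    {φ : ℝ → G → G} {g : G} (h : IsExponentiallyStable m φ g) : IsAsymptoticallyStable φ g := by
  obtain ⟨c, μ, hc, hμ, W, hW, hWe⟩ := h
  refine ⟨fun U hU => ?_, W ∩ {x | metricDist m x g < 1},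
    inter_mem hW (eventually_metricDist_lt m g one_pos), fun x hx => ?_⟩
  · obtain ⟨r, hr, hrU⟩ := exists_setOf_metricDist_lt_subset m hU
    refine ⟨W ∩ {x | metricDist m x g < r / ENNReal.ofReal c}, inter_mem hW
      (eventually_metricDist_lt m g (ENNReal.div_pos hr.ne' ENNReal.ofReal_ne_top)), ?_⟩
    rintro t ht _ ⟨x, ⟨hxW, hx⟩, rfl⟩
    refine hrU ?_
    have h1 : ENNReal.ofReal (c * Real.exp (-μ * t)) ≤ ENNReal.ofReal c :=
      ENNReal.ofReal_le_ofReal (mul_le_of_le_one_right hc.le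
        (Real.exp_le_one_iff.2 (by nlinarith)))
    calc metricDist m (φ t x) g
        ≤ ENNReal.ofReal (c * Real.exp (-μ * t)) * metricDist m x g := hWe x hxW t ht
      _ ≤ ENNReal.ofReal c * metricDist m x g := by gcongr
      _ < r := by
        rw [mul_comm]
        exact (ENNReal.lt_div_iff_mul_lt (Or.inl (ENNReal.ofReal_pos.2 hc).ne')
          (Or.inl ENNReal.ofReal_ne_top)).1 hx
  · rw [Filter.tendsto_def]
    intro U hU
    obtain ⟨r, hr, hrU⟩ := exists_setOf_metricDist_lt_subset m hU
    have h0 : Tendsto (fun t : ℝ => ENNReal.ofReal (c * Real.exp (-μ * t))) atTop (𝓝 0) := by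
      have h1 : Tendsto (fun t : ℝ => -μ * t) atTop atBot :=
        tendsto_id.const_mul_atTop_of_neg (by linarith)
      have h2 := ((Real.tendsto_exp_atBot.comp h1).const_mul c)
      have h3 := ENNReal.tendsto_ofReal h2
      simpa [Function.comp_def] using h3
    filter_upwards [h0.eventually_lt_const hr, eventually_ge_atTop 0] with t ht ht0
    refine hrU ?_
    calc metricDist m (φ t x) g
        ≤ ENNReal.ofReal (c * Real.exp (-μ * t)) * metricDist m x g := hWe x hx.1 t ht0
      _ ≤ ENNReal.ofReal (c * Real.exp (-μ * t)) * 1 := by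
        gcongr
        exact le_of_lt hx.2
      _ < r := by rwa [mul_one]

end Stability

end LinearFlow

theorem mainTheorem8 {E : Type*} [NormedAddCommGroup E] [NormedSpace ℝ E] [FiniteDimensional ℝ E]
    {G : Type*} [TopologicalSpace G] [ChartedSpace E G] [Group G] [LieGroup 𝓘(ℝ, E) ∞ G]
    [T2Space G] [ConnectedSpace G] [Nontrivial G]
    [LieAlgebra.IsSemisimple ℝ (GroupLieAlgebra 𝓘(ℝ, E) G)]
    (X : ∀ g : G, TangentSpace 𝓘(ℝ, E) g) (hX : LinearFlow.IsLinearVectorField X)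
    (φ : ℝ → G → G) (hφ : LinearFlow.IsFlow X φ)
    (g : G) (hg : LinearFlow.IsFixedPoint φ g) :
    ¬ LinearFlow.IsAsymptoticallyStable φ g ∧
      ∀ m : Bundle.ContMDiffRiemannianMetric 𝓘(ℝ, E) ∞ E
        (fun x : G => TangentSpace 𝓘(ℝ, E) x),
        ¬ LinearFlow.IsExponentiallyStable m φ g := by
  have : IsTopologicalGroup G := topologicalGroup_of_lieGroup 𝓘(ℝ, E) ∞
  have : CompleteSpace E := FiniteDimensional.complete ℝ E
  have : FiniteDimensional ℝ (GroupLieAlgebra 𝓘(ℝ, E) G) :=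
    inferInstanceAs (FiniteDimensional ℝ E)
  have : T2Space (GroupLieAlgebra 𝓘(ℝ, E) G) := inferInstanceAs (T2Space E)
  have hmain : ¬ LinearFlow.IsAsymptoticallyStable φ g := by
    intro hs
    obtain ⟨hXs, ψ, hψ, hψa⟩ := hX
    -- The automorphisms come with some flow of `X`; uniqueness of integral curves identifies it
    -- with `φ`.
    have hφψ : φ = ψ := by
      ext t x
      have := isMIntegralCurve_Ioo_eq_of_contMDiff_boundaryless (t₀ := 0)
        (hXs.of_le (by simp)) (hφ x).2 (hψ x).2 ((hφ x).1.trans (hψ x).1.symm)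
      exact congrFun this t
    choose F hF hFs hFs' using hψa
    have hφF : φ = fun t x => F t x := by
      ext t x; rw [hφψ, hF]
    have h1 : LinearFlow.IsAsymptoticallyStable (fun t x => F t x) (1 : G) := by
      subst hφF
      exact LinearFlow.IsAsymptoticallyStable.one_of_fixedPoint F hg hs
    have hsub : Subsingleton (GroupLieAlgebra 𝓘(ℝ, E) G) :=
      LinearFlow.subsingleton_of_tendsto_lieEquiv_zero (l := Filter.atTop)
      (fun t => LinearFlow.differentialLieEquiv (F t) (hFs t) (hFs' t))
      (LinearFlow.tendsto_differentialOne_zero F (fun t => (hFs t).mdifferentiable (by simp)) h1)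
    -- The Lie algebra is `E` as a vector space, so `G` is a manifold of dimension 0.
    have : Subsingleton E := hsub
    have : DiscreteTopology G := ChartedSpace.discreteTopology E G
    exact not_subsingleton G (PreconnectedSpace.trivial_of_discrete)
  exact ⟨hmain, fun m hm => hmain hm.isAsymptoticallyStable⟩
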